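/- A pseudovariety of semigroups is a class $\mathsf V$ of finite semigroups closed under taking subsemigroups, homomorphic images and finite direct products; it is nontrivial if some member has at least two elements. It is closed under concatenation if, for every finite alphabet $A$ and all languages $K,L\subseteq A^+$ each recognized by a homomorphism from $A^+$ into some member of $\mathsf V$, the product $KL=\{kl\mid k\in K,\ l\in L\}$ is also recognized by a homomorphism from $A^+$ into some member of $\mathsf V$. For a finite set $X$, let $\overline{\Omega}_X\mathsf V$ be the free pro-$\mathsf V$ semigroup on $X$, that is, the inverse limit of the quotients of the free semigroup $X^+$ that belong to $\mathsf V$. Let $\widehat{\mathbb N}$ be the profinite completion of the additive monoid $\mathbb N$. For $w\in\overline{\Omega}_X\mathsf V$ and $\alpha\in\widehat{\mathbb N}\setminus\mathbb N$, let $w^\alpha=\lim w^{n_k}$, where $(n_k)$ is any sequence of positive integers converging to $\alpha$. A $\bar u$-word over $\mathsf V$ is an element of the smallest subset of $\overline{\Omega}_X\mathsf V$ that contains (the images of the elements of) $X$ and is closed under multiplication and under all operations $w\mapsto w^\alpha$ with $\alpha\in\widehat{\mathbb N}\setminus\mathbb N$. **Corollary 2.4.** Let $X$ be a finite set with $|X|\ge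 2$ and let $\mathsf V$ be a nontrivial pseudovariety of semigroups closed under concatenation. Then $\overline{\Omega}_X\mathsf V$ has a minimum (two-sided) ideal, and this ideal contains no $\bar u$-word. -/

import Mathlib

universe u

namespace ProV

/-- A pseudovariety of semigroups: a class of finite semigroups that is closed under taking
(nonempty) subsemigroups, homomorphic images and finite direct products.
Closure under isomorphism is a special case of closure under homomorphic images. -/
structure Pseudovariety where
  /-- the semigroup `S` belongs to the class -/
  Mem : ∀ (S : Type u) [Semigroup S], Prop
  finite_of_mem : ∀ (S : Type u) [Semigroup S], Mem S → Finite S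
  mem_of_injective : ∀ (S T : Type u) [Semigroup S] [Semigroup T] [Nonempty S] (f : S →ₙ* T),
    Function.Injective f → Mem T → Mem S
  mem_of_surjective : ∀ (S T : Type u) [Semigroup S] [Semigroup T] (f : S →ₙ* T),
    Function.Surjective f → Mem S → Mem T
  mem_punit : Mem PUnit.{u + 1}
  mem_prod : ∀ (S T : Type u) [Semigroup S] [Semigroup T], Mem S → Mem T → Mem (S × T)

namespace Pseudovariety

/-- A pseudovariety is nontrivial if it has a member with at least two elements. -/
def IsNontrivial (V : Pseudovariety.{u}) : Prop :=
  ∃ (S : Type u) (_ : Semigroup S), V.Mem S ∧ Nontrivial S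

/-- The variety of (rational) languages of `V`: a language `L ⊆ A⁺` belongs to it if `L` is
recognized by a homomorphism from `A⁺` into some member of `V`. -/
def IsLanguage (V : Pseudovariety.{u}) {A : Type u} (L : Set (FreeSemigroup A)) : Prop :=
  ∃ (S : Type u) (_ : Semigroup S), V.Mem S ∧
    ∃ (φ : FreeSemigroup A →ₙ* S) (P : Set S), L = φ ⁻¹' P

/-- `V` is closed under concatenation if, over every finite alphabet, its variety of languages
is closed under the product `K L = {k l | k ∈ K, l ∈ L}`. -/
def IsClosedUnderConcatenation (V : Pseudovariety.{u}) : Prop :=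
  ∀ (A : Type u) [Finite A] (K L : Set (FreeSemigroup A)),
    V.IsLanguage K → V.IsLanguage L → V.IsLanguage (Set.image2 (fun k l => k * l) K L)

end Pseudovariety

/-- The profinite completion of the additive monoid `ℕ`: the inverse limit of the finite quotients
of `ℕ`. An element is a family of classes, one modulo each congruence of finite index, that is
compatible with the projections `ℕ / c → ℕ / d` for `c ≤ d`. -/
def NHat : Type :=
  {α : ∀ c : {c : AddCon ℕ // Finite c.Quotient}, c.1.Quotient //
    ∀ c d, c.1 ≤ d.1 → ∀ n : ℕ, α c = (n : c.1.Quotient) → α d = (n : d.1.Quotient)}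

namespace NHat

/-- The canonical map from `ℕ` into its profinite completion. -/
def ofNat (n : ℕ) : NHat :=
  ⟨fun c => (n : c.1.Quotient), fun _ d h _ hm =>
    (AddCon.eq d.1).2 (h ((AddCon.eq _).1 hm))⟩

/-- An exponent is infinite if it is not a natural number. -/
def IsInfinite (α : NHat) : Prop := α ∉ Set.range ofNat

end NHat

/-- The homomorphism `n ↦ s ^ n` from `ℕ` to `S¹`, the semigroup `S` with an identity adjoined. -/
def powHom {S : Type u} [Semigroup S] (s : S) : ℕ →+ Additive (WithOne S) :=
  multiplesHom _ (Additive.ofMul (s : WithOne S))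

theorem powHom_apply {S : Type u} [Semigroup S] (s : S) (n : ℕ) :
    powHom s n = Additive.ofMul ((s : WithOne S) ^ n) := by
  simp [powHom]

theorem finite_ker {S : Type u} [Semigroup S] [Finite S] (s : S) :
    Finite (AddCon.ker (powHom s)).Quotient := by
  have : Finite (WithOne S) := inferInstanceAs (Finite (Option S))
  have : Finite (Additive (WithOne S)) := inferInstanceAs (Finite (WithOne S))
  exact Finite.of_injective _ (AddCon.kerLift_injective (powHom s))

/-- The power `s ^ α` of an element `s` of a finite semigroup `S` for `α` in the profinite
completion of `ℕ`, calculated in `S¹`: the value at `α` of the unique continuous extension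
of `n ↦ s ^ n`. -/
def finPow {S : Type u} [Semigroup S] [Finite S] (s : S) (α : NHat) : WithOne S :=
  (AddCon.kerLift (powHom s) (α.1 ⟨AddCon.ker (powHom s), finite_ker s⟩)).toMul

theorem finPow_eq {S : Type u} [Semigroup S] [Finite S] (s : S) (α : NHat) (n : ℕ)
    (h : α.1 ⟨AddCon.ker (powHom s), finite_ker s⟩ = (n : (AddCon.ker (powHom s)).Quotient)) :
    finPow s α = (s : WithOne S) ^ n := by
  unfold finPow
  rw [h, AddCon.kerLift_mk, powHom_apply]
  rfl

theorem coe_pow_succ {S : Type u} [Semigroup S] (s : S) (n : ℕ) :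
    ∃ t : S, (s : WithOne S) ^ (n + 1) = t := by
  induction n with
  | zero => exact ⟨s, by simp⟩
  | succ n ih =>
    obtain ⟨t, ht⟩ := ih
    exact ⟨t * s, by rw [pow_succ, ht, WithOne.coe_mul]⟩

theorem finPow_ne_one {S : Type u} [Semigroup S] [Finite S] (s : S) (α : NHat)
    (hα : α.IsInfinite) : finPow s α ≠ 1 := by
  intro h
  apply hα
  refine ⟨0, Subtype.ext (funext fun c => ?_)⟩
  have := c.2
  have := finite_ker s
  let e : AddCon ℕ := c.1 ⊓ AddCon.ker (powHom s)
  have he : Finite e.Quotient := by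
    refine Finite.of_injective
      (fun q : e.Quotient => AddCon.liftOn q
        (fun n : ℕ => ((n : c.1.Quotient), (n : (AddCon.ker (powHom s)).Quotient)))
        (fun a b hab => Prod.ext ((AddCon.eq _).2 hab.1) ((AddCon.eq _).2 hab.2))) ?_
    intro p q
    induction p using AddCon.induction_on with | _ a
    induction q using AddCon.induction_on with | _ b
    intro hab
    exact (AddCon.eq _).2 ⟨(AddCon.eq _).1 (congrArg Prod.fst hab),
      (AddCon.eq _).1 (congrArg Prod.snd hab)⟩
  obtain ⟨n, hn⟩ : ∃ n : ℕ, α.1 ⟨e, he⟩ = (n : e.Quotient) := by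
    induction hq : α.1 ⟨e, he⟩ using AddCon.induction_on with | _ a
    exact ⟨a, rfl⟩
  have h1 := finPow_eq s α n (α.2 ⟨e, he⟩ ⟨_, finite_ker s⟩ inf_le_right n hn)
  have h0 : n = 0 := by
    rcases n with _ | m
    · rfl
    · obtain ⟨t, ht⟩ := coe_pow_succ s m
      rw [h, ht] at h1
      exact absurd h1.symm WithOne.coe_ne_one
  subst h0
  exact (α.2 ⟨e, he⟩ c inf_le_left 0 hn).symm

/-- The power `s ^ α ∈ S` of an element `s` of a finite semigroup `S`, for infinite `α`. -/
def infPow {S : Type u} [Semigroup S] [Finite S] (s : S) (α : NHat) (hα : α.IsInfinite) : S :=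
  WithOne.unone (finPow_ne_one s α hα)

theorem coe_infPow {S : Type u} [Semigroup S] [Finite S] (s : S) (α : NHat)
    (hα : α.IsInfinite) : ((infPow s α hα : S) : WithOne S) = finPow s α :=
  WithOne.coe_unone _

theorem map_infPow {S T : Type u} [Semigroup S] [Semigroup T] [Finite S] [Finite T]
    (f : S →ₙ* T) (s : S) (α : NHat) (hα : α.IsInfinite) :
    f (infPow s α hα) = infPow (f s) α hα := by
  apply WithOne.coe_injective
  rw [coe_infPow]
  obtain ⟨n, hn⟩ : ∃ n : ℕ, α.1 ⟨AddCon.ker (powHom s), finite_ker s⟩ =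
      (n : (AddCon.ker (powHom s)).Quotient) := by
    induction hq : α.1 ⟨AddCon.ker (powHom s), finite_ker s⟩ using AddCon.induction_on with | _ a
    exact ⟨a, rfl⟩
  have key : ∀ m : ℕ, (f s : WithOne T) ^ m = WithOne.mapMulHom f ((s : WithOne S) ^ m) := by
    intro m
    rw [map_pow, WithOne.mapMulHom_coe]
  have hle : AddCon.ker (powHom s) ≤ AddCon.ker (powHom (f s)) := by
    intro a b hab
    have hab' : powHom s a = powHom s b := hab
    change powHom (f s) a = powHom (f s) b
    rw [powHom_apply, powHom_apply] at hab' ⊢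
    rw [key, key, Additive.ofMul.injective hab']
  rw [finPow_eq (f s) α n (α.2 _ ⟨_, finite_ker (f s)⟩ hle n hn), key, ← finPow_eq s α n hn,
    ← coe_infPow s α hα, WithOne.mapMulHom_coe]

/-- The index set of the inverse system defining the free pro-`V` semigroup on `X`: the
congruences of the free semigroup `X⁺` whose quotient belongs to `V`. -/
def VCon (V : Pseudovariety.{u}) (X : Type u) : Type u :=
  {c : Con (FreeSemigroup X) // V.Mem c.Quotient}

/-- The free pro-`V` semigroup on `X`: the inverse limit of the quotients of `X⁺` that belong
to `V`. An element is a family of classes, one in each such quotient, that is compatible with the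
projections `X⁺ / c → X⁺ / d` for `c ≤ d`. -/
def FreeProV (V : Pseudovariety.{u}) (X : Type u) : Type u :=
  {w : ∀ c : VCon V X, c.1.Quotient //
    ∀ c d : VCon V X, c.1 ≤ d.1 → ∀ v : FreeSemigroup X,
      w c = (v : c.1.Quotient) → w d = (v : d.1.Quotient)}

namespace FreeProV

variable {V : Pseudovariety.{u}} {X : Type u}

/-- The natural homomorphism `X⁺ → FreeProV V X`. -/
def ofWord (v : FreeSemigroup X) : FreeProV V X :=
  ⟨fun c => (v : c.1.Quotient), fun _ d h _ hm => (Con.eq d.1).2 (h ((Con.eq _).1 hm))⟩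

/-- The generator of the free pro-`V` semigroup given by a letter. -/
def letter (x : X) : FreeProV V X := ofWord (FreeSemigroup.of x)

/-- The projection `X⁺ / c → X⁺ / d` for `c ≤ d`. -/
def proj {c d : Con (FreeSemigroup X)} (h : c ≤ d) : c.Quotient →ₙ* d.Quotient where
  toFun q := Con.liftOn q (fun v => (v : d.Quotient)) (fun _ _ hab => (Con.eq _).2 (h hab))
  map_mul' p q := by
    induction p using Con.induction_on
    induction q using Con.induction_on
    rfl

theorem proj_apply (w : FreeProV V X) (c d : VCon V X) (h : c.1 ≤ d.1) :
    proj h (w.1 c) = w.1 d := by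
  induction hq : w.1 c using Con.induction_on with | _ v
  exact (w.2 c d h v hq).symm

/-- A family that commutes with all projections is an element of the free pro-`V` semigroup. -/
def mkOfProj (w : ∀ c : VCon V X, c.1.Quotient)
    (hw : ∀ (c d : VCon V X) (h : c.1 ≤ d.1), proj h (w c) = w d) : FreeProV V X :=
  ⟨w, fun c d h v hv => by rw [← hw c d h, hv]; rfl⟩

/-- Multiplication is componentwise. -/
instance instSemigroup : Semigroup (FreeProV V X) where
  mul a b := mkOfProj (fun c => a.1 c * b.1 c) fun c d h => by
    rw [map_mul, proj_apply, proj_apply]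
  mul_assoc a b c := Subtype.ext (funext fun i => mul_assoc (a.1 i) (b.1 i) (c.1 i))

instance instFinite (c : VCon V X) : Finite c.1.Quotient := V.finite_of_mem _ c.2

/-- The implicit operation `w ↦ w ^ α` for infinite `α`, computed in each finite quotient. -/
def pow (w : FreeProV V X) (α : NHat) (hα : α.IsInfinite) : FreeProV V X :=
  mkOfProj (fun c => infPow (w.1 c) α hα) fun c d h => by
    rw [map_infPow, proj_apply]

/-- The `ū`-words over `V`: the elements of the smallest subset of the free pro-`V` semigroup that
contains the letters and is closed under multiplication and under all powers with infinite
exponent. -/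
inductive IsUWord : FreeProV V X → Prop
  | letter (x : X) : IsUWord (letter x)
  | mul (a b : FreeProV V X) : IsUWord a → IsUWord b → IsUWord (a * b)
  | pow (a : FreeProV V X) (α : NHat) (hα : α.IsInfinite) : IsUWord a → IsUWord (a.pow α hα)

end FreeProV

/-- A (two-sided) ideal of a semigroup: a nonempty subset absorbing multiplication on both sides. -/
def IsIdeal {S : Type u} [Semigroup S] (I : Set S) : Prop :=
  I.Nonempty ∧ ∀ a ∈ I, ∀ s : S, s * a ∈ I ∧ a * s ∈ I

/-- The minimum ideal: an ideal contained in every ideal. -/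
def IsMinimumIdeal {S : Type u} [Semigroup S] (K : Set S) : Prop :=
  IsLeast {I : Set S | IsIdeal I} K

end ProV

/-! The obstruction is factor complexity, the number of distinct factors of length `n`. A letter has
at most two; a product of two words adds at most `n` straddling factors; a power adds at most `n`,
whatever the exponent, by periodicity (`ncard_factors_flatten_replicate_le`). So for each `ū`-word
there is one constant `C` such that every finite quotient of `X⁺` in `V` represents it by a word
with at most `C * (n + 1)` factors of each length `n` (`IsUWord.exists_ncard_factors_le`).

By compactness the minimum ideal is the intersection of the sets `S s S`, so its elements have every
word `u` as a factor. Closure under concatenation makes `X⁺ u X⁺` a language of `V`, so in a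
suitable quotient every representing word contains `u` (`exists_infix_of_mem_twoSidedMul`). If `u`
contains all words of length `n`, these representatives have at least `2 ^ n` factors of length `n`,
too many for large `n`. -/

namespace List

/-! ### Factor complexity of lists -/

variable {X : Type u}

/-- The set of factors of length `n` of the list `l`. -/
def factors (n : ℕ) (l : List X) : Set (List X) := {u | u.length = n ∧ u <:+: l}

theorem mem_factors_iff {n : ℕ} {l u : List X} :
    u ∈ l.factors n ↔ ∃ i, i + n ≤ l.length ∧ u = (l.drop i).take n := by
  constructor
  · rintro ⟨rfl, s, t, rfl⟩
    refine ⟨s.length, by simp, by simp⟩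
  · rintro ⟨i, hi, rfl⟩
    refine ⟨by simp; omega, (take_prefix _ _).isInfix.trans (drop_suffix _ _).isInfix⟩

theorem finite_factors [Finite X] (n : ℕ) (l : List X) : (l.factors n).Finite :=
  (List.finite_length_eq X n).subset fun _ h => h.1

/-- A factor inside neither part straddles the cut, so it starts `j < n` letters before it. -/
theorem factors_append_subset (n : ℕ) (a b : List X) :
    (a ++ b).factors n ⊆ a.factors n ∪ b.factors n ∪
      (fun j => ((a ++ b).drop (a.length - j)).take n) '' (Finset.range n : Set ℕ) := by
  intro u hu
  obtain ⟨i, hi, rfl⟩ := mem_factors_iff.1 hu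
  rw [length_append] at hi
  rcases le_or_gt (i + n) a.length with h | h
  · refine Or.inl (Or.inl (mem_factors_iff.2 ⟨i, h, ?_⟩))
    rw [drop_append_of_le_length (by omega), take_append_of_le_length (by simp; omega)]
  · rcases le_or_gt a.length i with h' | h'
    · refine Or.inl (Or.inr (mem_factors_iff.2 ⟨i - a.length, by omega, ?_⟩))
      rw [drop_append, drop_eq_nil_of_le h', nil_append]
    · refine Or.inr ⟨a.length - i, by simp; omega, ?_⟩
      simp only
      rw [Nat.sub_sub_self h'.le]

theorem ncard_image_range_le {β : Type*} (f : ℕ → β) (n : ℕ) :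
    (f '' (Finset.range n : Set ℕ)).ncard ≤ n := by
  refine (Set.ncard_image_le (Finset.finite_toSet _)).trans ?_
  rw [Set.ncard_coe_finset, Finset.card_range]

theorem ncard_factors_append_le [Finite X] (n : ℕ) (a b : List X) :
    ((a ++ b).factors n).ncard ≤ (a.factors n).ncard + (b.factors n).ncard + n := by
  refine (Set.ncard_le_ncard (factors_append_subset n a b)
    (((finite_factors n a).union (finite_factors n b)).union
      ((Finset.finite_toSet _).image _))).trans ?_
  refine (Set.ncard_union_le _ _).trans (add_le_add (Set.ncard_union_le _ _) ?_)
  exact ncard_image_range_le _ n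

theorem take_drop_eq_of_prefix {n i : ℕ} {l l' : List X} (h : l <+: l') (hi : i + n ≤ l.length) :
    (l.drop i).take n = (l'.drop i).take n := by
  obtain ⟨t, rfl⟩ := h
  rw [drop_append_of_le_length (by omega), take_append_of_le_length (by simp; omega)]

/-- By periodicity, a factor starting after the first copy of `a` also occurs one copy earlier. What
remains starts in the first copy, either staying inside it or starting fewer than `n` letters before
its end. Reading the latter in a fixed power `K + 1` keeps the right-hand side constant during the
induction on `k`. -/
theorem factors_flatten_replicate_subset (n K : ℕ) (a : List X) (k : ℕ) (hk : k ≤ K) :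
    ((replicate (k + 1) a).flatten).factors n ⊆ a.factors n ∪
      (fun j => ((replicate (K + 1) a).flatten.drop (a.length - j)).take n) ''
        (Finset.range n : Set ℕ) := by
  induction k with
  | zero => simp
  | succ k ih =>
    intro u hu
    have hpre : (replicate (k + 1 + 1) a).flatten <+: (replicate (K + 1) a).flatten := by
      obtain ⟨d, rfl⟩ := Nat.exists_eq_add_of_le hk
      refine ⟨(replicate d a).flatten, ?_⟩
      rw [← flatten_append, replicate_append_replicate]
      congr 2
      omega
    obtain ⟨i, hi, rfl⟩ := mem_factors_iff.1 hu
    rcases le_or_gt (i + n) a.length with h | h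
    · refine Or.inl (mem_factors_iff.2 ⟨i, h, ?_⟩)
      refine (take_drop_eq_of_prefix ?_ h).symm
      rw [replicate_succ, flatten_cons]
      exact prefix_append _ _
    · rcases le_or_gt a.length i with h' | h'
      · refine ih (by omega) (mem_factors_iff.2 ⟨i - a.length, ?_, ?_⟩)
        · rw [replicate_succ, flatten_cons, length_append] at hi
          omega
        · rw [replicate_succ, flatten_cons, drop_append, drop_eq_nil_of_le h', nil_append]
      · refine Or.inr ⟨a.length - i, by simp; omega, ?_⟩
        simp only
        rw [Nat.sub_sub_self h'.le, take_drop_eq_of_prefix hpre hi]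

theorem ncard_factors_flatten_replicate_le [Finite X] (n k : ℕ) (a : List X) :
    ((replicate (k + 1) a).flatten.factors n).ncard ≤ (a.factors n).ncard + n := by
  refine (Set.ncard_le_ncard (factors_flatten_replicate_subset n k a k le_rfl)
    ((finite_factors n a).union ((Finset.finite_toSet _).image _))).trans ?_
  exact (Set.ncard_union_le _ _).trans (add_le_add le_rfl (ncard_image_range_le _ n))

theorem ncard_factors_singleton_le (n : ℕ) (x : X) : ([x].factors n).ncard ≤ 2 := by
  have hsub : [x].factors n ⊆ {[], [x]} := by
    rintro u ⟨-, hu⟩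
    rcases u with _ | ⟨y, t⟩
    · simp
    · have hl := hu.length_le
      simp only [length_cons, length_nil] at hl
      exact Or.inr (hu.eq_of_length_le (by simp))
  exact (Set.ncard_le_ncard hsub (by simp)).trans 
    ((Set.ncard_insert_le _ _).trans (by rw [Set.ncard_singleton]))

theorem pow_le_ncard_length_eq [Finite X] {m : ℕ} (hm : m ≤ Nat.card X) (n : ℕ) :
    m ^ n ≤ {l : List X | l.length = n}.ncard := by
  have := Fintype.ofFinite X
  have h : {l : List X | l.length = n}.ncard = Nat.card (List.Vector X n) := rfl
  rw [h, Nat.card_eq_fintype_card, card_vector, ← Nat.card_eq_fintype_card]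
  exact Nat.pow_le_pow_left hm n

end List

theorem exists_mul_succ_lt_two_pow (C : ℕ) : ∃ n, C * (n + 1) < 2 ^ n := by
  -- `2 ^ (3 * C)` is the cube of `2 ^ C ≥ C + 1`, and a cubic beats the quadratic on the left.
  refine ⟨3 * C, ?_⟩
  have h : C + 1 ≤ 2 ^ C := Nat.lt_two_pow_self
  calc C * (3 * C + 1) < (C + 1) ^ 3 := by nlinarith [Nat.zero_le (C ^ 3)]
    _ ≤ (2 ^ C) ^ 3 := Nat.pow_le_pow_left h 3
    _ = 2 ^ (3 * C) := by rw [← pow_mul, mul_comm]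

/-! ### Words and the endomorphism isolating a letter -/

namespace FreeSemigroup

variable {X : Type u}

/-- The nonempty list of letters of a word. -/
def letters (v : FreeSemigroup X) : List X := v.head :: v.tail

@[simp]
theorem letters_mul (v w : FreeSemigroup X) : (v * w).letters = v.letters ++ w.letters := rfl

theorem exists_letters_eq_flatten_replicate (v : FreeSemigroup X) (n : ℕ) :
    ∃ v' : FreeSemigroup X, v'.letters = (List.replicate (n + 1) v.letters).flatten ∧
      ∀ (S : Type u) [Semigroup S] (f : FreeSemigroup X →ₙ* S),
        (f v : WithOne S) ^ (n + 1) = (f v' : S) := by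
  induction n with
  | zero => exact ⟨v, by simp, fun S _ f => by simp⟩
  | succ n ih =>
    obtain ⟨v', h1, h2⟩ := ih
    refine ⟨v * v', ?_, fun S _ f => ?_⟩
    · rw [letters_mul, h1, List.replicate_succ (n := n + 1), List.flatten_cons]
    · rw [pow_succ', h2, map_mul, WithOne.coe_mul]

/-- Some word has all members of a given finite set of lists among its factors. -/
theorem exists_infix_letters [Nonempty X] {T : Set (List X)} (hT : T.Finite) :
    ∃ u : FreeSemigroup X, ∀ t ∈ T, t <:+: u.letters := by
  obtain ⟨x⟩ := ‹Nonempty X›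
  refine ⟨⟨x, hT.toFinset.toList.flatten⟩, fun t ht => ?_⟩
  exact (List.infix_of_mem_flatten (by simpa using ht)).trans (List.suffix_cons _ _).isInfix

theorem mem_image2_mul_univ_iff (v : FreeSemigroup X) :
    v ∈ Set.image2 (fun k l => k * l) (Set.univ : Set (FreeSemigroup X)) Set.univ ↔
      2 ≤ v.length := by
  constructor
  · rintro ⟨k, -, l, -, rfl⟩
    rw [length_mul, length, length]
    omega
  · intro h
    rcases v with ⟨x, _ | ⟨y, t⟩⟩
    · simp [length] at h
    · exact ⟨of x, trivial, ⟨y, t⟩, trivial, rfl⟩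

open Classical in
/-- The endomorphism of the free semigroup that fixes the letter `x` and squares the others. -/
noncomputable def squareOthers (x : X) : FreeSemigroup X →ₙ* FreeSemigroup X :=
  lift fun y => if y = x then of y else of y * of y

theorem length_le_length_squareOthers (x : X) (v : FreeSemigroup X) :
    v.length ≤ (squareOthers x v).length := by
  induction v using FreeSemigroup.recOnMul with
  | ih1 y =>
    rw [squareOthers, lift_of]
    split_ifs <;> simp
  | ih2 y v h1 h2 =>
    rw [map_mul, length_mul, length_mul]
    exact add_le_add h1 h2

/-- Reduces recognizing a single letter to recognizing length one, which is the complement of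
`X⁺X⁺`. -/
theorem length_squareOthers_lt_two_iff (x : X) (v : FreeSemigroup X) :
    (squareOthers x v).length < 2 ↔ v = of x := by
  constructor
  · intro h
    have h1 := (length_le_length_squareOthers x v).trans_lt h
    rcases v with ⟨y, _ | ⟨z, t⟩⟩
    · change (squareOthers x (of y)).length < 2 at h
      rw [squareOthers, lift_of] at h
      split_ifs at h with hy
      · rw [hy]; rfl
      · simp at h
    · simp [length] at h1
  · rintro rfl
    simp [squareOthers]

end FreeSemigroup

namespace ProV

variable {V : Pseudovariety.{u}} {X : Type u}

/-! ### Languages of a pseudovariety -/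

namespace Pseudovariety

theorem isLanguage_univ : V.IsLanguage (Set.univ : Set (FreeSemigroup X)) :=
  ⟨PUnit, inferInstance, V.mem_punit, ⟨fun _ => PUnit.unit, fun _ _ => rfl⟩, Set.univ, rfl⟩

theorem IsLanguage.compl {L : Set (FreeSemigroup X)} (hL : V.IsLanguage L) : V.IsLanguage Lᶜ := by
  obtain ⟨S, _, hS, φ, P, rfl⟩ := hL
  exact ⟨S, _, hS, φ, Pᶜ, rfl⟩

theorem IsLanguage.preimage {A : Type u} {L : Set (FreeSemigroup X)} (hL : V.IsLanguage L)
    (f : FreeSemigroup A →ₙ* FreeSemigroup X) : V.IsLanguage (f ⁻¹' L) := by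
  obtain ⟨S, _, hS, φ, P, rfl⟩ := hL
  exact ⟨S, _, hS, φ.comp f, P, rfl⟩

/-- The language `{x}` is the preimage under `squareOthers x` of the complement of `X⁺X⁺`; longer
words are concatenations of letters. -/
theorem isLanguage_singleton [Finite X] (hconc : V.IsClosedUnderConcatenation)
    (u : FreeSemigroup X) : V.IsLanguage {u} := by
  induction u using FreeSemigroup.recOnMul with
  | ih1 x =>
    have h := ((hconc X _ _ isLanguage_univ isLanguage_univ).compl).preimage
      (FreeSemigroup.squareOthers x)
    convert h using 1
    ext v
    rw [Set.mem_preimage, Set.mem_compl_iff, FreeSemigroup.mem_image2_mul_univ_iff, not_le,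
      FreeSemigroup.length_squareOthers_lt_two_iff, Set.mem_singleton_iff]
  | ih2 x v h1 h2 => simpa using hconc X _ _ h1 h2

/-- A language of `V` is saturated by a congruence whose quotient belongs to `V`. -/
theorem IsLanguage.exists_vCon [Nonempty X] {L : Set (FreeSemigroup X)} (hL : V.IsLanguage L) :
    ∃ c : VCon V X, ∀ v w, c.1 v w → v ∈ L → w ∈ L := by
  obtain ⟨S, _, hS, φ, P, rfl⟩ := hL
  have : Nonempty (Con.ker φ).Quotient :=
    ‹Nonempty X›.map fun x => ((FreeSemigroup.of x : FreeSemigroup X) : (Con.ker φ).Quotient)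
  let g : (Con.ker φ).Quotient →ₙ* S :=
    { toFun := fun q => Con.liftOn q φ fun _ _ h => h
      map_mul' := fun p q => by
        induction p using Con.induction_on
        induction q using Con.induction_on
        exact map_mul φ _ _ }
  refine ⟨⟨Con.ker φ, V.mem_of_injective _ S g ?_ hS⟩, fun v w h hv => ?_⟩
  · intro p q
    induction p using Con.induction_on
    induction q using Con.induction_on
    exact fun h => (Con.eq _).2 h
  · have h' : φ v = φ w := h
    change φ w ∈ P
    rw [← h']
    exact hv

end Pseudovariety

/-- In a finite semigroup an infinite exponent acts as some natural number, and not as `0`, since an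
infinite power is never the adjoined identity. -/
theorem exists_infPow_eq {S : Type u} [Semigroup S] [Finite S] (f : FreeSemigroup X →ₙ* S)
    (v : FreeSemigroup X) (α : NHat) (hα : α.IsInfinite) :
    ∃ (n : ℕ) (v' : FreeSemigroup X),
      v'.letters = (List.replicate (n + 1) v.letters).flatten ∧ infPow (f v) α hα = f v' := by
  obtain ⟨n, hn⟩ : ∃ n : ℕ, α.1 ⟨AddCon.ker (powHom (f v)), finite_ker (f v)⟩ =
      (n : (AddCon.ker (powHom (f v))).Quotient) := by
    induction hq : α.1 ⟨AddCon.ker (powHom (f v)), finite_ker (f v)⟩ using AddCon.induction_on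
      with | _ a
    exact ⟨a, rfl⟩
  have h := finPow_eq (f v) α n hn
  rcases n with _ | n
  · exact absurd (by simpa using h) (finPow_ne_one (f v) α hα)
  · obtain ⟨v', h1, h2⟩ := v.exists_letters_eq_flatten_replicate n
    exact ⟨n, v', h1, WithOne.coe_injective (by rw [coe_infPow, h, h2])⟩

/-! ### Linear complexity of `ū`-words -/

namespace FreeProV

/-- The quotient homomorphism `X⁺ → X⁺ / c`. -/
def quotientHom (c : Con (FreeSemigroup X)) : FreeSemigroup X →ₙ* c.Quotient where
  toFun v := v
  map_mul' _ _ := rfl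

theorem exists_eq_coe (w : FreeProV V X) (c : VCon V X) :
    ∃ v : FreeSemigroup X, w.1 c = (v : c.1.Quotient) := by
  induction hq : w.1 c using Con.induction_on with | _ v
  exact ⟨v, rfl⟩

/-- The value of a `ū`-word in each finite quotient is represented by words
of uniformly linear factor complexity. -/
theorem IsUWord.exists_ncard_factors_le [Finite X] {w : FreeProV V X} (hw : w.IsUWord) :
    ∃ C : ℕ, ∀ c : VCon V X, ∃ v : FreeSemigroup X, w.1 c = (v : c.1.Quotient) ∧
      ∀ n, (v.letters.factors n).ncard ≤ C * (n + 1) := by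
  induction hw with
  | letter x =>
    refine ⟨2, fun c => ⟨FreeSemigroup.of x, rfl, fun n => ?_⟩⟩
    exact (List.ncard_factors_singleton_le n x).trans (by omega)
  | mul a b _ _ iha ihb =>
    obtain ⟨C, hC⟩ := iha
    obtain ⟨D, hD⟩ := ihb
    -- The extra `1` pays for the at most `n` straddling factors.
    refine ⟨C + D + 1, fun c => ?_⟩
    obtain ⟨v, hv, hv'⟩ := hC c
    obtain ⟨t, ht, ht'⟩ := hD c
    refine ⟨v * t, ?_, fun n => ?_⟩
    · change a.1 c * b.1 c = _
      rw [hv, ht]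
      rfl
    · rw [FreeSemigroup.letters_mul]
      refine (List.ncard_factors_append_le n _ _).trans ?_
      have := hv' n
      have := ht' n
      linarith
  | pow a α hα _ iha =>
    obtain ⟨C, hC⟩ := iha
    refine ⟨C + 1, fun c => ?_⟩
    obtain ⟨v, hv, hv'⟩ := hC c
    -- The exponent `k` depends on the quotient `c`, but the complexity bound below does not depend
    -- on `k`.
    obtain ⟨k, v', h1, h2⟩ := exists_infPow_eq (quotientHom c.1) v α hα
    refine ⟨v', ?_, fun n => ?_⟩
    · change infPow (a.1 c) α hα = _
      rw [hv]
      exact h2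
    · rw [h1]
      refine (List.ncard_factors_flatten_replicate_le n k _).trans ?_
      have := hv' n
      linarith

/-- The profinite topology, for which the finite quotients are discrete. -/
instance instTopologicalSpace : TopologicalSpace (FreeProV V X) :=
  TopologicalSpace.induced Subtype.val (@Pi.topologicalSpace _ _ fun _ => ⊥)

end FreeProV

/-! ### The minimum ideal of a compact semigroup -/

/-- The set `S s S`. -/
def twoSidedMul {S : Type u} [Semigroup S] (s : S) : Set S :=
  Set.range fun p : S × S => p.1 * s * p.2

/-- A nonempty compact Hausdorff semigroup has a minimum ideal, the intersection of
the sets `S s S`. -/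
theorem isMinimumIdeal_iInter_twoSidedMul {S : Type u} [Semigroup S] [Nonempty S]
    [TopologicalSpace S] [CompactSpace S] [T2Space S] [ContinuousMul S] :
    IsMinimumIdeal (⋂ s : S, twoSidedMul s) := by
  have hcomp : ∀ s : S, IsCompact (twoSidedMul s) := fun s =>
    isCompact_range (by fun_prop)
  refine ⟨⟨?_, fun a ha t => ⟨?_, ?_⟩⟩, fun I hI a ha => ?_⟩
  · refine IsCompact.nonempty_iInter_of_directed_nonempty_isCompact_isClosed _ ?_
      (fun s => ⟨s * s * s, (s, s), rfl⟩) hcomp fun s => (hcomp s).isClosed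
    -- The family is directed because `S s t S` lies in both `S s S` and `S t S`.
    intro s t
    refine ⟨s * t, ?_, ?_⟩
    · rintro _ ⟨⟨a, b⟩, rfl⟩
      exact ⟨(a, t * b), by simp only [mul_assoc]⟩
    · rintro _ ⟨⟨a, b⟩, rfl⟩
      exact ⟨(a * s, b), by simp only [mul_assoc]⟩
  · refine Set.mem_iInter.2 fun s => ?_
    obtain ⟨⟨x, y⟩, rfl⟩ := Set.mem_iInter.1 ha s
    exact ⟨(t * x, y), by simp only [mul_assoc]⟩
  · refine Set.mem_iInter.2 fun s => ?_
    obtain ⟨⟨x, y⟩, rfl⟩ := Set.mem_iInter.1 ha s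
    exact ⟨(x, y * t), by simp only [mul_assoc]⟩
  · obtain ⟨s, hs⟩ := hI.1
    obtain ⟨⟨x, y⟩, rfl⟩ := Set.mem_iInter.1 ha s
    exact (hI.2 _ (hI.2 s hs x).1 y).2

/-! ### Compactness of the free pro-`V` semigroup and the contradiction -/

namespace FreeProV

/-- The discrete topology on the finite quotients of the free semigroup. -/
local instance instTopologicalSpaceQuotient (c : VCon V X) : TopologicalSpace c.1.Quotient := ⊥

local instance instDiscreteTopologyQuotient (c : VCon V X) : DiscreteTopology c.1.Quotient := ⟨rfl⟩

theorem isEmbedding_val :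
    Topology.IsEmbedding (Subtype.val : FreeProV V X → ∀ c : VCon V X, c.1.Quotient) :=
  Topology.IsEmbedding.subtypeVal

/-- Compatibility is a system of equations between continuous maps, so the limit is closed in a
product of finite discrete spaces; compactness follows by Tychonoff. -/
theorem isClosedEmbedding_val :
    Topology.IsClosedEmbedding (Subtype.val : FreeProV V X → ∀ c : VCon V X, c.1.Quotient) := by
  refine ⟨isEmbedding_val, ?_⟩
  have h : Set.range (Subtype.val : FreeProV V X → ∀ c : VCon V X, c.1.Quotient) =
      ⋂ (c : VCon V X) (d : VCon V X) (h : c.1 ≤ d.1), {w | proj h (w c) = w d} := by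
    ext w
    simp only [Set.mem_range, Set.mem_iInter, Set.mem_ofPred_eq]
    constructor
    · rintro ⟨w, rfl⟩ c d h
      exact proj_apply w c d h
    · exact fun hw => ⟨mkOfProj w hw, rfl⟩
  rw [h]
  refine isClosed_iInter fun c => isClosed_iInter fun d => isClosed_iInter fun h => ?_
  exact isClosed_eq ((continuous_of_discreteTopology (f := proj h)).comp (continuous_apply c))
    (continuous_apply d)

instance instCompactSpace : CompactSpace (FreeProV V X) :=
  isClosedEmbedding_val.compactSpace

instance instT2Space : T2Space (FreeProV V X) :=
  isEmbedding_val.t2Space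

instance instContinuousMul : ContinuousMul (FreeProV V X) where
  continuous_mul := by
    refine isEmbedding_val.continuous_iff.2 (continuous_pi fun c => ?_)
    have hc : Continuous fun w : FreeProV V X => w.1 c :=
      (continuous_apply c).comp isEmbedding_val.continuous
    exact (continuous_of_discreteTopology
      (f := fun p : c.1.Quotient × c.1.Quotient => p.1 * p.2)).comp
        ((hc.comp continuous_fst).prodMk (hc.comp continuous_snd))

/-- If `V` is closed under concatenation and `w` has the word `u` as a proper inner factor, then
so has every word representing `w` in a suitable finite quotient. -/
theorem exists_infix_of_mem_twoSidedMul [Finite X] [Nonempty X]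
    (hconc : V.IsClosedUnderConcatenation) {u : FreeSemigroup X} {w : FreeProV V X}
    (hw : w ∈ twoSidedMul (ofWord u : FreeProV V X)) :
    ∃ c : VCon V X, ∀ v : FreeSemigroup X, w.1 c = (v : c.1.Quotient) →
      u.letters <:+: v.letters := by
  -- The language `X⁺ u X⁺` belongs to `V`; the congruence `c` saturating it carries membership from
  -- one representative of `w` to all others.
  have hL := hconc X _ _ (hconc X _ _ Pseudovariety.isLanguage_univ
    (Pseudovariety.isLanguage_singleton hconc u)) Pseudovariety.isLanguage_univ
  obtain ⟨c, hc⟩ := hL.exists_vCon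
  refine ⟨c, fun v hv => ?_⟩
  obtain ⟨⟨a, b⟩, rfl⟩ := hw
  obtain ⟨a', ha⟩ := a.exists_eq_coe c
  obtain ⟨b', hb⟩ := b.exists_eq_coe c
  change a.1 c * (u : c.1.Quotient) * b.1 c = v at hv
  rw [ha, hb] at hv
  obtain ⟨_, ⟨k, -, _, rfl, rfl⟩, l, -, rfl⟩ := hc (a' * u * b') v ((Con.eq c.1).1 hv)
    ⟨a' * u, ⟨a', trivial, u, rfl, rfl⟩, b', trivial, rfl⟩
  exact ⟨k.letters, l.letters, by simp⟩

theorem IsUWord.exists_notMem_twoSidedMul [Finite X] (hX : 2 ≤ Nat.card X)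
    (hconc : V.IsClosedUnderConcatenation) {w : FreeProV V X} (hw : w.IsUWord) :
    ∃ s : FreeProV V X, w ∉ twoSidedMul s := by
  have : Nonempty X := (Nat.card_pos_iff.1 (by omega)).1
  obtain ⟨C, hC⟩ := hw.exists_ncard_factors_le
  obtain ⟨n, hn⟩ := exists_mul_succ_lt_two_pow C
  -- The quotient `c` is chosen only after `u`, hence after `n` and `C`, so it matters that `C` is
  -- uniform over all quotients.
  obtain ⟨u, hu⟩ := FreeSemigroup.exists_infix_letters (List.finite_length_eq X n)
  refine ⟨ofWord u, fun hmem => ?_⟩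
  obtain ⟨c, hc⟩ := exists_infix_of_mem_twoSidedMul hconc hmem
  obtain ⟨v, hv, hv'⟩ := hC c
  have hsub : {l : List X | l.length = n} ⊆ v.letters.factors n :=
    fun l hl => ⟨hl, (hu l hl).trans (hc v hv)⟩
  have h1 := Set.ncard_le_ncard hsub (List.finite_factors n _)
  have h2 := List.pow_le_ncard_length_eq hX n
  have h3 := hv' n
  omega

end FreeProV

end ProV

theorem corollary2p4 (V : ProV.Pseudovariety.{u}) (hV : V.IsNontrivial)
    (hconc : V.IsClosedUnderConcatenation) (X : Type u) [Finite X] (hX : 2 ≤ Nat.card X) :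
    ∃ K : Set (ProV.FreeProV V X),
      ProV.IsMinimumIdeal K ∧ ∀ w ∈ K, ¬ ProV.FreeProV.IsUWord w := by
  obtain ⟨x⟩ : Nonempty X := (Nat.card_pos_iff.1 (by omega)).1
  have : Nonempty (ProV.FreeProV V X) := ⟨ProV.FreeProV.letter x⟩
  refine ⟨_, ProV.isMinimumIdeal_iInter_twoSidedMul, fun w hw hu => ?_⟩
  obtain ⟨s, hs⟩ := hu.exists_notMem_twoSidedMul hX hconc
  exact hs (Set.mem_iInter.1 hw s)
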